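/- Let $\gamma\in(0,\infty)$ and let $\nu$ be a probability measure whose support is a compact subset of $(0,\infty)$. For $z\in\mathbb C_+=\{\mathrm{Im}\,z>0\}$ let $m(z)$ be the unique solution $m\in\mathbb C_-=\{\mathrm{Im}\,m<0\}$ of \[ m=\Bigl(z-\gamma\int\frac{\lambda}{1-m\lambda}\,\nu(d\lambda)\Bigr)^{-1}; \] $m(z)$ is the Cauchy transform $\int (z-x)^{-1}\mu(dx)$ of the probability measure $\mu$ which is the limiting spectral distribution of the complex Wishart matrices $\frac1N X_N\Sigma_NX_N^*$, where $X_N$ is $N\times n$, $n/N\to\gamma$ and the spectral distribution of $\Sigma_N$ converges to $\nu$. For real $x\neq0$ let $m(x)=\lim_{z\in\mathbb C_+,\,z\to x}m(z)$ and $\rho(x)=-\frac1\pi\mathrm{Im}\,m(x)$, so that $\mu(dx)=(1-\gamma)^+\delta_0+\rho(x)\,dx$. The bulk is the support of $\rho(x)\,dx$. A real $\mathfrak a$ is a left (resp. right) edge if, for all $\delta>0$ small enough, $\int_{\mathfrak a-\delta}^{\mathfrak a}\rho=0$ and $\int_{\mathfrak a}^{\mathfrak a+\delta}\rho>0$ (resp.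 $\int_{\mathfrak a-\delta}^{\mathfrak a}\rho>0$ and $\int_{\mathfrak a}^{\mathfrak a+\delta}\rho=0$). The bulk presents a hard edge if its leftmost edge is the origin, which is then a left edge. Let \[ g(m)=\frac1m+\gamma\int\frac{\lambda}{1-m\lambda}\,\nu(d\lambda). \] The map $z\mapsto g(1/z)$ extends holomorphically to a neighbourhood of $z=0$; let $g(\infty)$, $g'(\infty)$, $g''(\infty)$ be the value and the first two derivatives of this extension at $z=0$. \textbf{Proposition.} For all $z\in\mathbb C_+$ the solution $m(z)\in\mathbb C_-$ exists and is unique, and it equals the Cauchy transform at $z$ of any probability measure whose Cauchy transform solves the fixed-point equation, with values in $\mathbb C_-$, throughout $\mathbb C_+$; the limit $m(x)$ exists for all real $x\ne0$ close enough to $0$; and the extension of $z\mapsto g(1/z)$ by its limit at $0$ is holomorphic at $0$. The bulk presents a hard edge if and only if \[ g(\infty)=0,\qquad g'(\infty)=0,\qquad g''(\infty)<0, \] and it presents a hard edge if and only if $\gamma=1$. In this case, \[ \rho(x)=\frac1\pi\Bigl(\frac{2}{-g''(\infty)}\Bigr)^{-1/2}x^{-1/2}\,(1+o(1)),\qquad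 x\to0_+ . \] -/

import Mathlib

open MeasureTheory Filter Topology Asymptotics
open scoped ComplexOrder

noncomputable section

namespace Wishart

/-- The Cauchy transform `z ↦ ∫ (z - x)⁻¹ μ(dx)` of a measure on the real line. -/
def cauchyTransform (μ : Measure ℝ) (z : ℂ) : ℂ :=
  ∫ x : ℝ, (z - (x : ℂ))⁻¹ ∂μ

/-- `m` is a solution in the open lower half-plane of the fixed-point equation
`m = (z - γ ∫ t / (1 - m t) ν(dt))⁻¹`. -/
def IsFixedPoint (γ : ℝ) (ν : Measure ℝ) (z m : ℂ) : Prop :=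
  m.im < 0 ∧ m = (z - (γ : ℂ) * ∫ t : ℝ, (t : ℂ) / (1 - m * (t : ℂ)) ∂ν)⁻¹

/-- `μ` is the limiting spectral distribution with parameters `γ` and `ν`: the probability
measure whose Cauchy transform solves the fixed-point equation at each `z` in the upper
half-plane. -/
def IsLimitingMeasure (γ : ℝ) (ν μ : Measure ℝ) : Prop :=
  IsProbabilityMeasure μ ∧ ∀ z : ℂ, 0 < z.im → IsFixedPoint γ ν z (cauchyTransform μ z)

/-- The function `m(z)`, for `z` in the upper half-plane: the unique solution in the lower
half-plane of the fixed-point equation. It is the Cauchy transform of the limiting spectral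
distribution. -/
def limitingCauchyTransform (γ : ℝ) (ν : Measure ℝ) (z : ℂ) : ℂ :=
  Classical.epsilon (IsFixedPoint γ ν z)

/-- The boundary value `m(x)`, the limit of `m(z)` as `z → x` in the upper half-plane.
It exists for every real `x ≠ 0`. -/
def boundaryValue (γ : ℝ) (ν : Measure ℝ) (x : ℝ) : ℂ :=
  limUnder (𝓝[{z : ℂ | 0 < z.im}] (x : ℂ)) (limitingCauchyTransform γ ν)

/-- The density `ρ(x) = - π⁻¹ Im m(x)` of the limiting spectral distribution away from `0`
(its value at the single point `0` plays no role). -/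
def density (γ : ℝ) (ν : Measure ℝ) (x : ℝ) : ℝ :=
  -(1 / Real.pi) * (boundaryValue γ ν x).im

/-- Left edges of the support of `ρ(x) dx`. -/
def IsLeftEdge (ρ : ℝ → ℝ) (a : ℝ) : Prop :=
  ∀ᶠ δ in 𝓝[>] (0 : ℝ), (∫ x in (a - δ)..a, ρ x) = 0 ∧ 0 < ∫ x in a..(a + δ), ρ x

/-- Right edges of the support of `ρ(x) dx`. -/
def IsRightEdge (ρ : ℝ → ℝ) (a : ℝ) : Prop :=
  ∀ᶠ δ in 𝓝[>] (0 : ℝ), 0 < (∫ x in (a - δ)..a, ρ x) ∧ (∫ x in a..(a + δ), ρ x) = 0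

/-- The bulk, i.e. the support of `ρ(x) dx`, presents a hard edge: the origin is a left edge,
and it is the leftmost of all edges. -/
def HasHardEdge (ρ : ℝ → ℝ) : Prop :=
  IsLeftEdge ρ 0 ∧ ∀ a : ℝ, IsLeftEdge ρ a ∨ IsRightEdge ρ a → 0 ≤ a

/-- The map `g(m) = 1/m + γ ∫ t / (1 - m t) ν(dt)`. -/
def g (γ : ℝ) (ν : Measure ℝ) (m : ℂ) : ℂ :=
  1 / m + (γ : ℂ) * ∫ t : ℝ, (t : ℂ) / (1 - m * (t : ℂ)) ∂ν

/-- The map `g` in the chart at infinity: `z ↦ g(1/z)` for `z ≠ 0`, extended to `z = 0` by its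
limit there. -/
def gChart (γ : ℝ) (ν : Measure ℝ) : ℂ → ℂ :=
  Function.update (fun z : ℂ => g γ ν (1 / z)) 0
    (limUnder (𝓝[≠] (0 : ℂ)) fun z : ℂ => g γ ν (1 / z))

/-- `g(∞)`. -/
def gInfty (γ : ℝ) (ν : Measure ℝ) : ℂ := gChart γ ν 0

/-- `g'(∞)`: the first derivative at `z = 0` of `z ↦ g(1/z)`. -/
def gInfty' (γ : ℝ) (ν : Measure ℝ) : ℂ := deriv (gChart γ ν) 0

/-- `g''(∞)`: the second derivative at `z = 0` of `z ↦ g(1/z)`. -/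
def gInfty'' (γ : ℝ) (ν : Measure ℝ) : ℂ := iteratedDeriv 2 (gChart γ ν) 0

end Wishart

end

/-!
In the variable `w = 1 / m` the fixed-point equation at `z` reads `h w = z`, where
`h w = g (1 / w) = w + γ w ∫ t / (w - t) ν(dt)` (`gRecip`). This map is holomorphic off the support
of `ν`, in particular at `w = 0`, so that it is the chart of `g` at infinity, and there
`h 0 = 0`, `h' 0 = 1 - γ` and `h'' 0 = -2 γ κ` with `κ = ∫ t⁻¹ ν(dt) > 0`. The three conditions on
`g` at infinity thus amount to `γ = 1`, and it remains to show that `γ = 1` characterizes a hard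
edge and to find the density there.

Everything rests on two identities: the divided difference of `h` between `w` and `v` is
`1 - γ ∫ t² / ((w - t) (v - t)) ν(dt)` (`gRecip_sub_gRecip`), and
`Im h(w) = Im w * (1 - γ ∫ t² / |w - t|² ν(dt))` (`gRecip_im`). If `Im w` and `Im h(w)` are both
positive, the last integral is less than one, and the first identity gives uniqueness
(`gRecip_injOn`). Existence follows by iterating `w ↦ z + w - h w`, which contracts a function of
the hyperbolic distance of the upper half-plane (`exists_gRecip_eq`).

At a real point left of the support at which `h' > 0`, the local inverse of `h` preserves the
upper half-plane and the real line; so it is `1 / m` near the image point, and the density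
vanishes there (`eventually_tendsto_ofReal`). For `γ < 1` this applies at `w = 0`; for `γ > 1`, at
a negative zero of `h`; in both cases there is no bulk near the origin
(`eventually_tendsto_ofReal_of_ne_one`). For `γ = 1` it applies at a negative preimage of each
`x < 0` (`tendsto_ofReal_of_neg`), while `h w = - w² ∫ (t - w)⁻¹ ν(dt)` is minus the square of a
locally invertible function `k` with `k' 0 = √κ`. Over small `x > 0` the solution is
`w = k⁻¹ (i √x) ~ i √(x / κ)`, whence the boundary value `m ~ -i √(κ / x)`
(`exists_boundary_expansion`) and the density `√(κ / x) / π`.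
-/

noncomputable section

namespace Wishart

/-! ### The map in the variable `w = 1 / m` -/

/-- The map `g` in the variable `w = 1 / m`, that is `w ↦ g (1 / w)`, in the form
`w + γ w ∫ t / (w - t) ν(dt)`, which is also meaningful at `w = 0`. -/
def gRecip (γ : ℝ) (ν : Measure ℝ) (w : ℂ) : ℂ :=
  w + γ * (w * ∫ t : ℝ, (t : ℂ) / (w - t) ∂ν)

/-- The quantity `γ ∫ t² / |w - t|² ν(dt)`. It bounds the modulus of the derivative of
`w ↦ w - gRecip γ ν w`, and `1 - shrink γ ν w` is the factor by which `gRecip γ ν` multiplies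
imaginary parts. -/
def shrink (γ : ℝ) (ν : Measure ℝ) (w : ℂ) : ℝ :=
  γ * ∫ t : ℝ, t ^ 2 / Complex.normSq (w - t) ∂ν

variable {γ : ℝ} {ν : Measure ℝ} {a b : ℝ}

lemma gRecip_zero : gRecip γ ν 0 = 0 := by simp [gRecip]

lemma g_one_div {w : ℂ} (hw : w ≠ 0) : g γ ν (1 / w) = gRecip γ ν w := by
  unfold g gRecip
  rw [one_div_one_div, ← integral_const_mul w]
  congr 3
  ext t
  rw [show 1 - 1 / w * (t : ℂ) = (w - t) / w by field_simp, div_div_eq_mul_div]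
  ring

lemma isFixedPoint_inv_iff {z w : ℂ} :
    IsFixedPoint γ ν z w⁻¹ ↔ 0 < w.im ∧ gRecip γ ν w = z := by
  have him : w⁻¹.im < 0 ↔ 0 < w.im := by
    rcases eq_or_ne w 0 with rfl | hw
    · simp
    · rw [Complex.inv_im, div_neg_iff]
      have := Complex.normSq_pos.2 hw
      constructor
      · rintro (h | h) <;> linarith [h.1, h.2]
      · intro h
        exact Or.inr ⟨by linarith, this⟩
  unfold IsFixedPoint
  rw [him]
  refine and_congr_right fun h => ?_
  have hw : w ≠ 0 := by rintro rfl; simp at h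
  rw [inv_inj, ← g_one_div hw, g, one_div_one_div, one_div, eq_sub_iff_add_eq]

/-! ### Integrals of Cauchy type off the support -/

/-- The complex number `w` avoids the interval `[a, b]`, which carries the measure. -/
def OffIcc (a b : ℝ) (w : ℂ) : Prop := ∀ t ∈ Set.Icc a b, w ≠ (t : ℂ)

lemma offIcc_of_im {w : ℂ} (h : 0 < w.im) : OffIcc a b w := by
  rintro t - rfl
  simp at h

lemma offIcc_of_lt {x : ℝ} (h : x < a) : OffIcc a b (x : ℂ) := by
  intro t ht e
  have := Complex.ofReal_injective e
  linarith [ht.1]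

/-- A point off the interval has a ball around it that stays at a fixed distance from the
interval. -/
lemma OffIcc.exists_ball {w : ℂ} (h : OffIcc a b w) :
    ∃ ε > 0, ∀ w' ∈ Metric.ball w ε, ∀ t ∈ Set.Icc a b, ε ≤ ‖w' - (t : ℂ)‖ := by
  have hc : IsClosed ((fun t : ℝ => (t : ℂ)) '' Set.Icc a b) :=
    (isCompact_Icc.image Complex.continuous_ofReal).isClosed
  have hw : w ∈ ((fun t : ℝ => (t : ℂ)) '' Set.Icc a b)ᶜ := by
    rintro ⟨t, ht, e⟩
    exact h t ht e.symm
  obtain ⟨r, hr, hsub⟩ := Metric.isOpen_iff.1 hc.isOpen_compl w hw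
  refine ⟨r / 2, by positivity, fun w' hw' t ht => ?_⟩
  by_contra! hlt
  refine hsub (a := (t : ℂ)) ?_ ⟨t, ht, rfl⟩
  rw [Metric.mem_ball, dist_eq_norm] at *
  calc ‖(t : ℂ) - w‖ = ‖(w' - w) - (w' - t)‖ := by congr 1; ring
    _ ≤ ‖w' - w‖ + ‖w' - t‖ := norm_sub_le _ _
    _ < r := by linarith

lemma OffIcc.eventually {w : ℂ} (h : OffIcc a b w) : ∀ᶠ w' in 𝓝 w, OffIcc a b w' := by
  obtain ⟨ε, hε, H⟩ := h.exists_ball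
  filter_upwards [Metric.ball_mem_nhds w hε] with w' hw' t ht e
  have := H w' hw' t ht
  rw [e] at this
  simp at this
  linarith

lemma ae_mem_Icc (hν : ν (Set.Icc a b)ᶜ = 0) : ∀ᵐ t ∂ν, t ∈ Set.Icc a b := hν

lemma integrable_of_continuousOn_Icc [IsFiniteMeasure ν] {E : Type*} [NormedAddCommGroup E]
    (hν : ν (Set.Icc a b)ᶜ = 0) {f : ℝ → E} (hf : ContinuousOn f (Set.Icc a b)) :
    Integrable f ν := by
  have h := hf.integrableOn_compact (μ := ν) isCompact_Icc
  rwa [IntegrableOn, Measure.restrict_eq_self_of_ae_mem (ae_mem_Icc hν)] at h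

lemma OffIcc.sub_ne {w : ℂ} (h : OffIcc a b w) {t : ℝ} (ht : t ∈ Set.Icc a b) :
    w - t ≠ 0 := sub_ne_zero.2 (h t ht)

lemma OffIcc.continuousOn_div {w : ℂ} (h : OffIcc a b w) {φ : ℝ → ℂ} (hφ : Continuous φ) :
    ContinuousOn (fun t : ℝ => φ t / (w - t)) (Set.Icc a b) :=
  hφ.continuousOn.div (by fun_prop) fun _ ht => h.sub_ne ht

lemma hasDerivAt_integral_div_sub [IsFiniteMeasure ν] (hν : ν (Set.Icc a b)ᶜ = 0) {w : ℂ}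
    (h : OffIcc a b w) {φ : ℝ → ℂ} (hφ : Continuous φ) :
    HasDerivAt (fun w : ℂ => ∫ t : ℝ, φ t / (w - t) ∂ν)
      (∫ t : ℝ, -φ t / (w - t) ^ 2 ∂ν) w := by
  obtain ⟨ε, hε, H⟩ := h.exists_ball
  have hm : ∀ w : ℂ, AEStronglyMeasurable (fun t : ℝ => φ t / (w - t)) ν := fun w =>
    (hφ.measurable.div (by fun_prop)).aestronglyMeasurable
  refine (hasDerivAt_integral_of_dominated_loc_of_deriv_le (F := fun w t => φ t / (w - t))
    (F' := fun w t => -φ t / (w - t) ^ 2) (bound := fun t => ‖φ t‖ / ε ^ 2)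
    (Metric.ball_mem_nhds w hε) (Eventually.of_forall hm)
    (integrable_of_continuousOn_Icc hν (h.continuousOn_div hφ)) ?_ ?_ ?_ ?_).2
  · exact (hφ.measurable.neg.div (by fun_prop)).aestronglyMeasurable
  · filter_upwards [ae_mem_Icc hν] with t ht w' hw'
    rw [norm_div, norm_neg, norm_pow]
    have := H w' hw' t ht
    gcongr
  · exact integrable_of_continuousOn_Icc hν (by fun_prop)
  · filter_upwards [ae_mem_Icc hν] with t ht w' hw'
    have hne : w' - t ≠ 0 := by
      intro e
      have := H w' hw' t ht
      rw [e, norm_zero] at this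
      linarith
    have := ((hasDerivAt_const w' (φ t)).div ((hasDerivAt_id w').sub_const (t : ℂ)) hne)
    exact this.congr_deriv (by simp)

lemma analyticAt_integral_div_sub [IsFiniteMeasure ν] (hν : ν (Set.Icc a b)ᶜ = 0) {w : ℂ}
    (h : OffIcc a b w) {φ : ℝ → ℂ} (hφ : Continuous φ) :
    AnalyticAt ℂ (fun w : ℂ => ∫ t : ℝ, φ t / (w - t) ∂ν) w := by
  rw [Complex.analyticAt_iff_eventually_differentiableAt]
  filter_upwards [h.eventually] with w' hw'
  exact (hasDerivAt_integral_div_sub hν hw' hφ).differentiableAt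

lemma analyticAt_gRecip [IsFiniteMeasure ν] (hν : ν (Set.Icc a b)ᶜ = 0) {w : ℂ}
    (h : OffIcc a b w) : AnalyticAt ℂ (gRecip γ ν) w := by
  have := analyticAt_integral_div_sub hν h Complex.continuous_ofReal
  unfold gRecip
  fun_prop

lemma integrable_sq_div_normSq [IsFiniteMeasure ν] (hν : ν (Set.Icc a b)ᶜ = 0) {w : ℂ}
    (h : OffIcc a b w) :
    Integrable (fun t : ℝ => t ^ 2 / Complex.normSq (w - t)) ν := by
  refine integrable_of_continuousOn_Icc hν (ContinuousOn.div (by fun_prop) ?_ fun t ht => ?_)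
  · exact (Complex.continuous_normSq.comp (by fun_prop)).continuousOn
  · exact (Complex.normSq_pos.2 (h.sub_ne ht)).ne'

lemma gRecip_sub_gRecip [IsFiniteMeasure ν] (hν : ν (Set.Icc a b)ᶜ = 0) {w v : ℂ}
    (hw : OffIcc a b w) (hv : OffIcc a b v) :
    gRecip γ ν w - gRecip γ ν v =
      (w - v) * (1 - γ * ∫ t : ℝ, (t : ℂ) ^ 2 / ((w - t) * (v - t)) ∂ν) := by
  have iw := integrable_of_continuousOn_Icc hν (hw.continuousOn_div Complex.continuous_ofReal)
  have iv := integrable_of_continuousOn_Icc hν (hv.continuousOn_div Complex.continuous_ofReal)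
  have key : w * (∫ t : ℝ, (t : ℂ) / (w - t) ∂ν) - v * (∫ t : ℝ, (t : ℂ) / (v - t) ∂ν) =
      -(w - v) * ∫ t : ℝ, (t : ℂ) ^ 2 / ((w - t) * (v - t)) ∂ν := by
    rw [← integral_const_mul, ← integral_const_mul, ← integral_const_mul,
      ← integral_sub (iw.const_mul w) (iv.const_mul v)]
    refine integral_congr_ae ?_
    filter_upwards [ae_mem_Icc hν] with t ht
    have h1 := hw.sub_ne ht
    have h2 := hv.sub_ne ht
    field_simp
    ring
  unfold gRecip
  linear_combination (γ : ℂ) * key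

lemma gRecip_im [IsFiniteMeasure ν] (hν : ν (Set.Icc a b)ᶜ = 0) {w : ℂ} (hw : OffIcc a b w) :
    (gRecip γ ν w).im = w.im * (1 - shrink γ ν w) := by
  have iw := (integrable_of_continuousOn_Icc hν
    (hw.continuousOn_div Complex.continuous_ofReal)).const_mul w
  have key : (w * ∫ t : ℝ, (t : ℂ) / (w - t) ∂ν).im =
      -w.im * ∫ t : ℝ, t ^ 2 / Complex.normSq (w - t) ∂ν := by
    rw [← integral_const_mul, ← integral_const_mul]
    rw [← RCLike.im_eq_complex_im, ← integral_im iw]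
    refine integral_congr_ae ?_
    filter_upwards [ae_mem_Icc hν] with t ht
    have h1 := (Complex.normSq_pos.2 (hw.sub_ne ht)).ne'
    simp only [RCLike.im_eq_complex_im]
    rw [← mul_div_assoc, Complex.div_im]
    simp
    field_simp
    ring
  rw [gRecip, Complex.add_im, Complex.im_ofReal_mul, key]
  unfold shrink
  ring

/-- The derivative of `gRecip` at a real point is the factor acting on imaginary parts. -/
lemma hasStrictDerivAt_gRecip_ofReal [IsFiniteMeasure ν] (hν : ν (Set.Icc a b)ᶜ = 0) {x : ℝ}
    (hx : OffIcc a b (x : ℂ)) :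
    HasStrictDerivAt (gRecip γ ν) ((1 - shrink γ ν x : ℝ) : ℂ) x := by
  have h1 := analyticAt_gRecip (γ := γ) hν hx
  have hJ := hasDerivAt_integral_div_sub hν hx Complex.continuous_ofReal
  have h2 : HasDerivAt (gRecip γ ν) _ (x : ℂ) :=
    (hasDerivAt_id (x : ℂ)).add (((hasDerivAt_id (x : ℂ)).mul hJ).const_mul (γ : ℂ))
  refine h1.hasStrictDerivAt.congr_deriv ?_
  rw [h2.deriv]
  have i1 := integrable_of_continuousOn_Icc hν (hx.continuousOn_div Complex.continuous_ofReal)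
  have i2 : Integrable (fun t : ℝ => -(t : ℂ) / (x - t) ^ 2) ν :=
    integrable_of_continuousOn_Icc hν (ContinuousOn.div (by fun_prop) (by fun_prop)
      fun t ht => pow_ne_zero 2 (hx.sub_ne ht))
  have key : (∫ t : ℝ, (t : ℂ) / (x - t) ∂ν) + x * (∫ t : ℝ, -(t : ℂ) / (x - t) ^ 2 ∂ν) =
      -((∫ t : ℝ, t ^ 2 / Complex.normSq ((x : ℂ) - t) ∂ν : ℝ) : ℂ) := by
    rw [← integral_const_mul, ← integral_add i1 (i2.const_mul _), ← integral_complex_ofReal,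
      ← integral_neg]
    refine integral_congr_ae ?_
    filter_upwards [ae_mem_Icc hν] with t ht
    have h3 := hx.sub_ne ht
    rw [← Complex.ofReal_sub, Complex.normSq_ofReal]
    push_cast
    field_simp
    ring
  simp only [id, one_mul] at key ⊢
  rw [key, shrink]
  push_cast
  ring

lemma continuousAt_shrink [IsFiniteMeasure ν] (hν : ν (Set.Icc a b)ᶜ = 0) {w : ℂ}
    (hw : OffIcc a b w) : ContinuousAt (shrink γ ν) w := by
  obtain ⟨ε, hε, H⟩ := hw.exists_ball
  refine continuousAt_const.mul ?_
  refine continuousAt_of_dominated (bound := fun t => t ^ 2 / ε ^ 2) ?_ ?_ ?_ ?_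
  · refine Eventually.of_forall fun v => Measurable.aestronglyMeasurable ?_
    exact (measurable_id.pow_const 2).div (Complex.continuous_normSq.comp (by fun_prop)).measurable
  · filter_upwards [Metric.ball_mem_nhds w hε] with v hv
    filter_upwards [ae_mem_Icc hν] with t ht
    have := H v hv t ht
    rw [Complex.normSq_eq_norm_sq, norm_div, norm_pow, norm_pow, norm_norm, Real.norm_eq_abs,
      sq_abs]
    gcongr
  · exact integrable_of_continuousOn_Icc hν (by fun_prop)
  · filter_upwards [ae_mem_Icc hν] with t ht
    refine ContinuousAt.div continuousAt_const ?_ (Complex.normSq_pos.2 (hw.sub_ne ht)).ne'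
    exact (Complex.continuous_normSq.comp (by fun_prop)).continuousAt

/-! ### Existence and uniqueness of the solution -/

/-- Weighted arithmetic-geometric mean bound. With a suitable `l` it plays the role of the
Cauchy-Schwarz inequality for the integral on the left. -/
lemma norm_integral_sq_div_mul_le [IsFiniteMeasure ν] (hγ : 0 < γ) (hν : ν (Set.Icc a b)ᶜ = 0)
    {w v : ℂ} (hw : OffIcc a b w) (hv : OffIcc a b v) {l : ℝ} (hl : 0 < l) :
    ‖(γ : ℂ) * ∫ t : ℝ, (t : ℂ) ^ 2 / ((w - t) * (v - t)) ∂ν‖ ≤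
      (l * shrink γ ν w + l⁻¹ * shrink γ ν v) / 2 := by
  have iw := integrable_sq_div_normSq hν hw
  have iv := integrable_sq_div_normSq hν hv
  rw [norm_mul, Complex.norm_real, Real.norm_of_nonneg hγ.le]
  have key : ‖∫ t : ℝ, (t : ℂ) ^ 2 / ((w - t) * (v - t)) ∂ν‖ ≤
      ∫ t : ℝ, (l / 2 * (t ^ 2 / Complex.normSq (w - t)) +
        l⁻¹ / 2 * (t ^ 2 / Complex.normSq (v - t))) ∂ν := by
    refine norm_integral_le_of_norm_le ((iw.const_mul _).add (iv.const_mul _)) ?_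
    filter_upwards [ae_mem_Icc hν] with t ht
    have h1 : 0 < ‖w - t‖ := norm_pos_iff.2 (hw.sub_ne ht)
    have h2 : 0 < ‖v - t‖ := norm_pos_iff.2 (hv.sub_ne ht)
    rw [norm_div, norm_mul, norm_pow, Complex.norm_real, Real.norm_eq_abs, sq_abs,
      Complex.normSq_eq_norm_sq, Complex.normSq_eq_norm_sq]
    have h3 := mul_nonneg (mul_nonneg (sq_nonneg t) (inv_nonneg.2 hl.le))
      (sq_nonneg (l / ‖w - t‖ - 1 / ‖v - t‖))
    have h4 : t ^ 2 * l⁻¹ * (l / ‖w - t‖ - 1 / ‖v - t‖) ^ 2 =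
        2 * ((l / 2 * (t ^ 2 / ‖w - t‖ ^ 2) + l⁻¹ / 2 * (t ^ 2 / ‖v - t‖ ^ 2)) -
          t ^ 2 / (‖w - t‖ * ‖v - t‖)) := by
      field_simp
      ring
    linarith
  rw [integral_add (iw.const_mul _) (iv.const_mul _), integral_const_mul,
    integral_const_mul] at key
  calc _ ≤ γ * _ := mul_le_mul_of_nonneg_left key hγ.le
    _ = _ := by unfold shrink; ring

lemma shrink_lt_one [IsFiniteMeasure ν] (hν : ν (Set.Icc a b)ᶜ = 0) {w : ℂ} (hw : 0 < w.im)
    (h : 0 < (gRecip γ ν w).im) : shrink γ ν w < 1 := by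
  rw [gRecip_im hν (offIcc_of_im hw)] at h
  have := (pos_iff_pos_of_mul_pos h).1 hw
  linarith

/-- Injectivity over the upper half-plane: two preimages `w ≠ v` of one point would make the
divided difference of `gRecip` vanish, while both values of `shrink` are below `1`. -/
lemma gRecip_injOn [IsFiniteMeasure ν] (hγ : 0 < γ) (hν : ν (Set.Icc a b)ᶜ = 0) {w v : ℂ}
    (hw : 0 < w.im) (hv : 0 < v.im) (h : 0 < (gRecip γ ν w).im)
    (e : gRecip γ ν w = gRecip γ ν v) : w = v := by
  have h1 := shrink_lt_one hν hw h
  have h2 := shrink_lt_one hν hv (e ▸ h)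
  have h3 := gRecip_sub_gRecip (γ := γ) hν (offIcc_of_im (a := a) (b := b) hw)
    (offIcc_of_im (a := a) (b := b) hv)
  have h4 := norm_integral_sq_div_mul_le hγ hν (offIcc_of_im (a := a) (b := b) hw)
    (offIcc_of_im (a := a) (b := b) hv) one_pos
  rw [e, sub_self, eq_comm, mul_eq_zero] at h3
  rcases h3 with h3 | h3
  · exact sub_eq_zero.1 h3
  · rw [← sub_eq_zero.1 h3, norm_one] at h4
    linarith

lemma shrink_nonneg (hγ : 0 < γ) (w : ℂ) : 0 ≤ shrink γ ν w :=
  mul_nonneg hγ.le (integral_nonneg fun t => div_nonneg (sq_nonneg t) (Complex.normSq_nonneg _))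

lemma im_mul_shrink_le [IsFiniteMeasure ν] (hγ : 0 < γ) (hν : ν (Set.Icc a b)ᶜ = 0) {w : ℂ}
    {y : ℝ} (hy : 0 < y) (hw : y ≤ w.im) :
    w.im * shrink γ ν w ≤ γ * (∫ t : ℝ, t ^ 2 ∂ν) / y := by
  have hw0 : 0 < w.im := hy.trans_le hw
  have h2 : ∫ t : ℝ, t ^ 2 / Complex.normSq (w - t) ∂ν ≤
      ∫ t : ℝ, (w.im ^ 2)⁻¹ * t ^ 2 ∂ν := by
    refine integral_mono (integrable_sq_div_normSq hν (offIcc_of_im hw0))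
      ((integrable_of_continuousOn_Icc hν (by fun_prop)).const_mul _) fun t => ?_
    have : w.im ^ 2 ≤ Complex.normSq (w - t) := by
      rw [Complex.normSq_apply]
      simp
      nlinarith [mul_self_nonneg (w.re - t)]
    simp only
    rw [mul_comm, ← div_eq_mul_inv]
    gcongr
  rw [integral_const_mul] at h2
  have hI : 0 ≤ ∫ t : ℝ, t ^ 2 ∂ν := integral_nonneg fun t => sq_nonneg t
  calc w.im * shrink γ ν w ≤ w.im * (γ * ((w.im ^ 2)⁻¹ * ∫ t : ℝ, t ^ 2 ∂ν)) := by
        unfold shrink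
        gcongr
    _ = γ * (∫ t : ℝ, t ^ 2 ∂ν) / w.im := by field_simp
    _ ≤ _ := by gcongr

/-- The map `w ↦ z + w - gRecip γ ν w` sends the half-plane `y ≤ Im w`, `y = Im z`, into a strip
`y ≤ Im w ≤ y + M`, and contracts `|w - v| / √(Im w Im v)`, a function of the hyperbolic
distance. Its iterates therefore converge, to a preimage of `z` under `gRecip`. -/
lemma exists_gRecip_eq [IsFiniteMeasure ν] (hγ : 0 < γ) (hν : ν (Set.Icc a b)ᶜ = 0) {z : ℂ}
    (hz : 0 < z.im) : ∃ w : ℂ, 0 < w.im ∧ gRecip γ ν w = z := by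
  set y := z.im with hydef
  set M := γ * (∫ t : ℝ, t ^ 2 ∂ν) / y with hM
  have hM0 : 0 ≤ M := by
    have hI : 0 ≤ ∫ t : ℝ, t ^ 2 ∂ν := integral_nonneg fun t => sq_nonneg t
    positivity
  set F : ℂ → ℂ := fun w => z + (w - gRecip γ ν w) with hF
  have off : ∀ {w : ℂ}, y ≤ w.im → OffIcc a b w := fun h => offIcc_of_im (hz.trans_le h)
  have Fim : ∀ w, y ≤ w.im → (F w).im = y + w.im * shrink γ ν w := by
    intro w hw
    simp only [hF, Complex.add_im, Complex.sub_im, gRecip_im hν (off hw)]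
    ring
  have Flo : ∀ w, y ≤ w.im → y ≤ (F w).im := by
    intro w hw
    rw [Fim w hw]
    have := mul_nonneg (hz.le.trans hw) (shrink_nonneg (ν := ν) hγ w)
    linarith
  have Fhi : ∀ w, y ≤ w.im → (F w).im ≤ y + M := by
    intro w hw
    rw [Fim w hw]
    have := im_mul_shrink_le hγ hν hz hw
    linarith
  set k := M / (y + M) with hk
  have hyM : 0 < y + M := by linarith
  have hk0 : 0 ≤ k := by positivity
  have hk1 : k < 1 := by rw [hk, div_lt_one hyM]; linarith
  have shr : ∀ w, y ≤ w.im → shrink γ ν w ≤ k * ((F w).im / w.im) := by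
    intro w hw
    have hw0 : 0 < w.im := hz.trans_le hw
    have h1 := Fim w hw
    have h2 := Fhi w hw
    rw [← mul_div_assoc, le_div_iff₀ hw0, hk, div_mul_eq_mul_div, le_div_iff₀ hyM]
    nlinarith
  set d : ℂ → ℂ → ℝ := fun w v => ‖w - v‖ / √(w.im * v.im) with hd
  have contr : ∀ w v, y ≤ w.im → y ≤ v.im → d (F w) (F v) ≤ k * d w v := by
    intro w v hw hv
    have hw0 : 0 < w.im := hz.trans_le hw
    have hv0 : 0 < v.im := hz.trans_le hv
    have hFw : 0 < (F w).im := hz.trans_le (Flo w hw)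
    have hFv : 0 < (F v).im := hz.trans_le (Flo v hv)
    have e1 : F w - F v =
        (w - v) * ((γ : ℂ) * ∫ t : ℝ, (t : ℂ) ^ 2 / ((w - t) * (v - t)) ∂ν) := by
      have := gRecip_sub_gRecip (γ := γ) hν (off hw) (off hv)
      simp only [hF]
      linear_combination -this
    -- With `A` and `B` the factors by which `F` stretches imaginary parts, the weight `√B / √A`
    -- turns the arithmetic mean into the geometric mean `√A * √B`.
    set A := (F w).im / w.im with hA
    set B := (F v).im / v.im with hB
    have hA0 : 0 < A := by positivity
    have hB0 : 0 < B := by positivity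
    have sA := Real.sqrt_pos.2 hA0
    have sB := Real.sqrt_pos.2 hB0
    have e2 := norm_integral_sq_div_mul_le hγ hν (off hw) (off hv)
      (l := √B / √A) (by positivity)
    have e3 : (√B / √A * shrink γ ν w + (√B / √A)⁻¹ * shrink γ ν v) / 2 ≤ k * (√A * √B) := by
      have h1 := shr w hw
      have h2 := shr v hv
      calc _ ≤ (√B / √A * (k * A) + (√B / √A)⁻¹ * (k * B)) / 2 := by gcongr
        _ = (√B / √A * (k * (√A * √A)) + (√B / √A)⁻¹ * (k * (√B * √B))) / 2 := by
            rw [Real.mul_self_sqrt hA0.le, Real.mul_self_sqrt hB0.le]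
        _ = _ := by field_simp; ring
    have e4 : √A * √B = √((F w).im * (F v).im) / √(w.im * v.im) := by
      rw [← Real.sqrt_mul hA0.le, ← Real.sqrt_div (by positivity), hA, hB]
      congr 1
      field_simp
    have s1 : 0 < √((F w).im * (F v).im) := Real.sqrt_pos.2 (by positivity)
    simp only [hd]
    rw [e1, norm_mul, div_le_iff₀ s1]
    calc _ ≤ ‖w - v‖ * (k * (√A * √B)) := by
          gcongr
          exact e2.trans e3
      _ = _ := by rw [e4]; ring
  set u : ℕ → ℂ := fun n => F^[n] z with hu
  have usucc : ∀ n, u (n + 1) = F (u n) := fun n => Function.iterate_succ_apply' F n z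
  have ulo : ∀ n, y ≤ (u n).im := by
    intro n
    induction n with
    | zero => exact le_rfl
    | succ n ih => rw [usucc]; exact Flo _ ih
  have uhi : ∀ n, (u n).im ≤ y + M := by
    intro n
    cases n with
    | zero => simp [hu, hM0, ← hydef]
    | succ n => rw [usucc]; exact Fhi _ (ulo n)
  have ud : ∀ n, d (u n) (u (n + 1)) ≤ d (u 0) (u 1) * k ^ n := by
    intro n
    induction n with
    | zero => simp
    | succ n ih =>
      calc d (u (n + 1)) (u (n + 2)) ≤ k * d (u n) (u (n + 1)) := by
            rw [usucc (n + 1), usucc n]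
            exact contr _ _ (ulo n) (by rw [← usucc]; exact ulo _)
        _ ≤ k * (d (u 0) (u 1) * k ^ n) := by gcongr
        _ = _ := by ring
  have udist : ∀ n, dist (u n) (u (n + 1)) ≤ ((y + M) * d (u 0) (u 1)) * k ^ n := by
    intro n
    have p1 : 0 < (u n).im := hz.trans_le (ulo n)
    have p2 : 0 < (u (n + 1)).im := hz.trans_le (ulo (n + 1))
    have s1 : 0 < √((u n).im * (u (n + 1)).im) := Real.sqrt_pos.2 (by positivity)
    have s2 : √((u n).im * (u (n + 1)).im) ≤ y + M := by
      rw [Real.sqrt_le_left hyM.le, sq]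
      exact mul_le_mul (uhi _) (uhi _) p2.le hyM.le
    have := ud n
    calc dist (u n) (u (n + 1)) = √((u n).im * (u (n + 1)).im) * d (u n) (u (n + 1)) := by
          rw [dist_eq_norm]; simp only [hd]; field_simp
      _ ≤ (y + M) * (d (u 0) (u 1) * k ^ n) := by gcongr
      _ = _ := by ring
  obtain ⟨w, hw⟩ := cauchySeq_tendsto_of_complete (cauchySeq_of_le_geometric k _ hk1 udist)
  have wlo : y ≤ w.im :=
    ge_of_tendsto' ((Complex.continuous_im.tendsto w).comp hw) ulo
  have hFc : ContinuousAt F w :=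
    continuousAt_const.add (continuousAt_id.sub (analyticAt_gRecip hν (off wlo)).continuousAt)
  have hfix : F w = w := by
    refine tendsto_nhds_unique (hFc.tendsto.comp hw) ?_
    have := (tendsto_add_atTop_iff_nat 1).2 hw
    exact this.congr fun n => usucc n
  refine ⟨w, hz.trans_le wlo, ?_⟩
  simp only [hF] at hfix
  linear_combination -hfix

lemma existsUnique_isFixedPoint [IsFiniteMeasure ν] (hγ : 0 < γ) (hν : ν (Set.Icc a b)ᶜ = 0)
    {z : ℂ} (hz : 0 < z.im) : ∃! m : ℂ, IsFixedPoint γ ν z m := by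
  obtain ⟨w, hw, e⟩ := exists_gRecip_eq hγ hν hz
  refine ⟨w⁻¹, isFixedPoint_inv_iff.2 ⟨hw, e⟩, fun m hm => ?_⟩
  simp only at hm
  rw [← inv_inv m, isFixedPoint_inv_iff] at hm
  rw [← gRecip_injOn hγ hν hm.1 hw (by rwa [hm.2]) (hm.2.trans e.symm), inv_inv]

lemma limitingCauchyTransform_eq [IsFiniteMeasure ν] (hγ : 0 < γ) (hν : ν (Set.Icc a b)ᶜ = 0)
    {z m : ℂ} (hz : 0 < z.im) (hm : IsFixedPoint γ ν z m) :
    limitingCauchyTransform γ ν z = m :=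
  (existsUnique_isFixedPoint hγ hν hz).unique (Classical.epsilon_spec ⟨m, hm⟩) hm

lemma limitingCauchyTransform_gRecip [IsFiniteMeasure ν] (hγ : 0 < γ)
    (hν : ν (Set.Icc a b)ᶜ = 0) {z w : ℂ} (hz : 0 < z.im) (hw : 0 < w.im)
    (e : gRecip γ ν w = z) : limitingCauchyTransform γ ν z = w⁻¹ :=
  limitingCauchyTransform_eq hγ hν hz (isFixedPoint_inv_iff.2 ⟨hw, e⟩)

/-! ### Boundary values outside the bulk -/

instance neBot_nhdsWithin_upperHalfPlane (x : ℝ) :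
    (𝓝[{z : ℂ | 0 < z.im}] (x : ℂ)).NeBot := by
  rw [← mem_closure_iff_nhdsWithin_neBot, Complex.closure_setOfPred_lt_im]
  simp

lemma boundaryValue_eq {x : ℝ} {m : ℂ}
    (h : Tendsto (limitingCauchyTransform γ ν) (𝓝[{z : ℂ | 0 < z.im}] (x : ℂ)) (𝓝 m)) :
    boundaryValue γ ν x = m :=
  h.limUnder_eq

lemma exists_local_rightInverse {f : ℂ → ℂ} {f' c : ℂ} (hf : HasStrictDerivAt f f' c)
    (hf' : f' ≠ 0) : ∃ φ : ℂ → ℂ, φ (f c) = c ∧ HasStrictDerivAt φ f'⁻¹ (f c) ∧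
      ∀ᶠ z in 𝓝 (f c), f (φ z) = z ∧ ContinuousAt φ z := by
  have hd := hf.to_localInverse hf'
  obtain ⟨K, s, hs, hK⟩ := hd.hasStrictFDerivAt.exists_lipschitzOnWith
  refine ⟨_, (hf.hasStrictFDerivAt_equiv hf').localInverse_apply_image, hd, ?_⟩
  filter_upwards [hf.eventually_right_inverse hf', eventually_mem_nhds_iff.2 hs] with z h1 h2
  exact ⟨h1, hK.continuousOn.continuousAt h2⟩

/-- Near the image of a real point at which `gRecip` has positive derivative, the local inverse
of `gRecip` preserves the upper half-plane and the real line; hence it is `1 / m`, and `m` has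
real boundary values. -/
lemma eventually_tendsto_ofReal [IsFiniteMeasure ν] (hγ : 0 < γ) (hν : ν (Set.Icc a b)ᶜ = 0)
    {x y : ℝ} (hx : x < a) (hs : shrink γ ν x < 1) (hxy : gRecip γ ν x = y) :
    ∀ᶠ s : ℝ in 𝓝 y, s ≠ 0 → ∃ r : ℝ, Tendsto (limitingCauchyTransform γ ν)
      (𝓝[{z : ℂ | 0 < z.im}] (s : ℂ)) (𝓝 (r : ℂ)) := by
  have hoff : OffIcc a b (x : ℂ) := offIcc_of_lt hx
  obtain ⟨φ, hφ0, hφd, hφ⟩ := exists_local_rightInverse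
    (hasStrictDerivAt_gRecip_ofReal (γ := γ) hν hoff)
    (Complex.ofReal_ne_zero.2 (by linarith))
  rw [hxy] at hφ0 hφd hφ
  have hφc : Tendsto φ (𝓝 (y : ℂ)) (𝓝 (x : ℂ)) := by
    have := hφd.hasDerivAt.continuousAt.tendsto
    rwa [hφ0] at this
  have hP : ∀ᶠ z in 𝓝 (y : ℂ), (gRecip γ ν (φ z) = z ∧ ContinuousAt φ z) ∧
      OffIcc a b (φ z) ∧ shrink γ ν (φ z) < 1 :=
    hφ.and ((hφc.eventually hoff.eventually).and
      (hφc.eventually ((continuousAt_shrink hν hoff).eventually_lt_const hs)))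
  filter_upwards [(Complex.continuous_ofReal.tendsto y).eventually
    (eventually_eventually_nhds.2 hP)] with s hsP hs0
  obtain ⟨⟨e, hc⟩, ho, hlt⟩ := hsP.self_of_nhds
  have him : (φ s).im = 0 := by
    have := gRecip_im (γ := γ) hν ho
    rw [e, Complex.ofReal_im, eq_comm, mul_eq_zero] at this
    exact this.resolve_right (by linarith)
  have hreal : ((φ s).re : ℂ) = φ s := Complex.ext rfl (by simp [him])
  have hne : φ s ≠ 0 := by
    intro h0
    rw [h0, gRecip_zero] at e
    exact hs0 (Complex.ofReal_eq_zero.1 e.symm)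
  refine ⟨(φ s).re⁻¹, ?_⟩
  rw [Complex.ofReal_inv, hreal]
  refine ((hc.tendsto.inv₀ hne).mono_left nhdsWithin_le_nhds).congr' ?_
  filter_upwards [nhdsWithin_le_nhds hsP, self_mem_nhdsWithin] with z hz hzim
  obtain ⟨⟨e', -⟩, ho', hlt'⟩ := hz
  refine (limitingCauchyTransform_gRecip hγ hν hzim ?_ e').symm
  have h1 := gRecip_im (γ := γ) hν ho'
  rw [e'] at h1
  have h2 : 0 < (φ z).im * (1 - shrink γ ν (φ z)) := h1 ▸ hzim
  exact (pos_iff_pos_of_mul_pos h2).2 (by linarith)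

lemma density_eq_zero {x r : ℝ} (h : Tendsto (limitingCauchyTransform γ ν)
    (𝓝[{z : ℂ | 0 < z.im}] (x : ℂ)) (𝓝 (r : ℂ))) : density γ ν x = 0 := by
  simp [density, boundaryValue_eq h]

/-! ### Real preimages of the points outside the bulk -/

lemma gRecip_ofReal (x : ℝ) :
    gRecip γ ν x = ((x + γ * (x * ∫ t : ℝ, t / (x - t) ∂ν) : ℝ) : ℂ) := by
  unfold gRecip
  push_cast
  rw [← integral_complex_ofReal]
  push_cast
  rfl

lemma shrink_zero [IsProbabilityMeasure ν] (ha : 0 < a) (hν : ν (Set.Icc a b)ᶜ = 0) :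
    shrink γ ν 0 = γ := by
  have : ∫ t : ℝ, t ^ 2 / Complex.normSq (0 - t) ∂ν = ∫ _ : ℝ, (1 : ℝ) ∂ν := by
    refine integral_congr_ae ?_
    filter_upwards [ae_mem_Icc hν] with t ht
    have : t ≠ 0 := (ha.trans_le ht.1).ne'
    simp [Complex.normSq_neg, Complex.normSq_ofReal]
    field_simp
  rw [shrink, this]
  simp

/-- On the negative axis `gRecip γ ν` has positive derivative wherever its value is not
positive. -/
lemma shrink_lt_one_of_neg [IsProbabilityMeasure ν] (hγ : 0 < γ) (ha : 0 < a)
    (hν : ν (Set.Icc a b)ᶜ = 0) {x y : ℝ} (hx : x < 0) (hy : y ≤ 0)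
    (hxy : gRecip γ ν x = y) : shrink γ ν x < 1 := by
  have hab : a ≤ b := by
    by_contra! h
    simp [Set.Icc_eq_empty_of_lt h] at hν
  rw [gRecip_ofReal, Complex.ofReal_inj] at hxy
  have hoff : OffIcc a b (x : ℂ) := offIcc_of_lt (hx.trans ha)
  have hne : ∀ t ∈ Set.Icc a b, t - x ≠ 0 := fun t ht => by linarith [ht.1]
  have hi : Integrable (fun t : ℝ => t / (t - x)) ν :=
    integrable_of_continuousOn_Icc hν (ContinuousOn.div (by fun_prop) (by fun_prop) hne)
  have e : ∫ t : ℝ, t / (x - t) ∂ν = -∫ t : ℝ, t / (t - x) ∂ν := by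
    rw [← integral_neg]
    congr 1
    ext t
    rw [← div_neg, neg_sub]
  have h1 : γ * ∫ t : ℝ, t / (t - x) ∂ν ≤ 1 := by
    rw [e] at hxy
    by_contra! h
    nlinarith
  have h2 : ∫ t : ℝ, t ^ 2 / Complex.normSq (x - t) ∂ν ≤
      ∫ t : ℝ, b / (b - x) * (t / (t - x)) ∂ν := by
    refine integral_mono_ae (integrable_sq_div_normSq hν hoff) (hi.const_mul _) ?_
    filter_upwards [ae_mem_Icc hν] with t ht
    have p1 : 0 < t := ha.trans_le ht.1
    have p2 : 0 < t - x := by linarith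
    have p3 : 0 < b - x := by linarith
    rw [← Complex.ofReal_sub, Complex.normSq_ofReal]
    calc t ^ 2 / ((x - t) * (x - t)) = t / (t - x) * (t / (t - x)) := by
          rw [div_mul_div_comm]; congr 1 <;> ring
      _ ≤ b / (b - x) * (t / (t - x)) := by
          gcongr ?_ * _
          rw [div_le_div_iff₀ p2 p3]
          nlinarith [ht.2]
  rw [integral_const_mul] at h2
  have hb : 0 < b := ha.trans_le hab
  have p3 : 0 < b - x := by linarith
  calc shrink γ ν x ≤ γ * (b / (b - x) * ∫ t : ℝ, t / (t - x) ∂ν) := by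
        unfold shrink; gcongr
    _ = b / (b - x) * (γ * ∫ t : ℝ, t / (t - x) ∂ν) := by ring
    _ ≤ b / (b - x) * 1 := by gcongr
    _ < 1 := by rw [mul_one, div_lt_one p3]; linarith

/-- On the negative axis `gRecip γ ν` attains every value below one of its values, as it is
continuous and tends to `-∞` at `-∞`. -/
lemma exists_lt_gRecip_eq [IsProbabilityMeasure ν] (hγ : 0 < γ) (ha : 0 < a)
    (hν : ν (Set.Icc a b)ᶜ = 0) {x y : ℝ} (hx : x ≤ 0) (hy : y < (gRecip γ ν x).re) :
    ∃ x' < x, gRecip γ ν (x' : ℂ) = y := by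
  have hcont : ContinuousOn (fun s : ℝ => (gRecip γ ν s).re) (Set.Iic 0) := by
    intro s hs
    have hs' : s < a := lt_of_le_of_lt hs ha
    have h1 := (analyticAt_gRecip (γ := γ) hν (offIcc_of_lt hs')).continuousAt
    exact (Complex.continuous_re.continuousAt.comp
      (h1.comp Complex.continuous_ofReal.continuousAt)).continuousWithinAt
  set c := γ * ∫ t : ℝ, t ∂ν
  have hlow : ∀ s : ℝ, s ≤ 0 → (gRecip γ ν s).re ≤ s + c := by
    intro s hs
    rw [gRecip_ofReal, Complex.ofReal_re]
    refine add_le_add_right (mul_le_mul_of_nonneg_left ?_ hγ.le) s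
    rw [← integral_const_mul]
    refine integral_mono_ae ?_ (integrable_of_continuousOn_Icc hν continuousOn_id) ?_
    · exact (integrable_of_continuousOn_Icc hν (ContinuousOn.div (by fun_prop) (by fun_prop)
        fun t ht => by linarith [ht.1])).const_mul _
    · filter_upwards [ae_mem_Icc hν] with t ht
      have p1 : 0 < t := ha.trans_le ht.1
      have p2 : 0 < t - s := by linarith
      calc s * (t / (s - t)) = -s * t / (t - s) := by
            rw [← neg_sub t s, div_neg]; ring
        _ ≤ t := by
            rw [div_le_iff₀ p2]
            nlinarith
  set l := min (y - c) x
  have hl0 : l ≤ x := min_le_right _ _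
  have hl : (gRecip γ ν l).re ≤ y := by
    have := hlow l (hl0.trans hx)
    have : l ≤ y - c := min_le_left _ _
    linarith
  obtain ⟨x', hx', e⟩ := intermediate_value_Icc hl0
    (hcont.mono fun s hs => hs.2.trans hx) ⟨hl, hy.le⟩
  simp only at e
  refine ⟨x', lt_of_le_of_ne hx'.2 ?_, ?_⟩
  · rintro rfl
    linarith
  · rw [← e, gRecip_ofReal, Complex.ofReal_re]

/-- For `γ ≠ 1` there is no bulk near the origin: the origin is the image under `gRecip` of a
point with positive derivative, which is `0` itself if `γ < 1` and a negative point if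
`1 < γ`. -/
lemma eventually_tendsto_ofReal_of_ne_one [IsProbabilityMeasure ν] (hγ : 0 < γ) (ha : 0 < a)
    (hν : ν (Set.Icc a b)ᶜ = 0) (h1 : γ ≠ 1) :
    ∀ᶠ s : ℝ in 𝓝 0, s ≠ 0 → ∃ r : ℝ, Tendsto (limitingCauchyTransform γ ν)
      (𝓝[{z : ℂ | 0 < z.im}] (s : ℂ)) (𝓝 (r : ℂ)) := by
  rcases h1.lt_or_gt with h | h
  · refine eventually_tendsto_ofReal hγ hν (x := 0) ha ?_ ?_
    · rw [Complex.ofReal_zero, shrink_zero ha hν]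
      exact h
    · rw [Complex.ofReal_zero, gRecip_zero]
  · have hd := (hasStrictDerivAt_gRecip_ofReal (γ := γ) (x := 0) hν
      (offIcc_of_lt ha)).hasDerivAt.real_of_complex
    rw [Complex.ofReal_re, Complex.ofReal_zero, shrink_zero ha hν,
      hasDerivAt_iff_tendsto_slope] at hd
    have hsub : Set.Iio (0 : ℝ) ⊆ {0}ᶜ := fun s hs => ne_of_lt hs
    have hneg := (hd.mono_left (nhdsWithin_mono 0 hsub)).eventually_lt_const (sub_neg.2 h)
    obtain ⟨s, hs, hs0⟩ := (hneg.and self_mem_nhdsWithin).exists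
    rw [slope_def_field, Complex.ofReal_zero, gRecip_zero, Complex.zero_re, sub_zero,
      sub_zero] at hs
    have hs0' : s < 0 := hs0
    have hpos : 0 < (gRecip γ ν s).re := by
      rw [div_neg_iff] at hs
      rcases hs with hs | hs <;> linarith [hs.1, hs.2]
    obtain ⟨x, hx, e⟩ := exists_lt_gRecip_eq hγ ha hν hs0'.le hpos
    have hx0 : x < 0 := hx.trans hs0'
    exact eventually_tendsto_ofReal hγ hν (hx0.trans ha)
      (shrink_lt_one_of_neg hγ ha hν hx0 le_rfl e) e

lemma tendsto_ofReal_of_neg [IsProbabilityMeasure ν] (ha : 0 < a)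
    (hν : ν (Set.Icc a b)ᶜ = 0) {y : ℝ} (hy : y < 0) :
    ∃ r : ℝ, Tendsto (limitingCauchyTransform 1 ν)
      (𝓝[{z : ℂ | 0 < z.im}] (y : ℂ)) (𝓝 (r : ℂ)) := by
  obtain ⟨x, hx, e⟩ := exists_lt_gRecip_eq (γ := 1) one_pos ha hν (x := 0) (y := y) le_rfl
    (by simpa [gRecip_zero] using hy)
  exact (eventually_tendsto_ofReal one_pos hν (hx.trans ha)
    (shrink_lt_one_of_neg one_pos ha hν hx hy.le e) e).self_of_nhds hy.ne

/-! ### The square root singularity at the origin -/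

lemma integral_inv_pos [IsProbabilityMeasure ν] (ha : 0 < a) (hν : ν (Set.Icc a b)ᶜ = 0) :
    0 < ∫ t : ℝ, t⁻¹ ∂ν := by
  have hi : Integrable (fun t : ℝ => t⁻¹) ν :=
    integrable_of_continuousOn_Icc hν (continuousOn_id.inv₀ fun t ht => (ha.trans_le ht.1).ne')
  have hpos : ∀ᵐ t ∂ν, 0 < t⁻¹ := by
    filter_upwards [ae_mem_Icc hν] with t ht using inv_pos.2 (ha.trans_le ht.1)
  rw [integral_pos_iff_support_of_nonneg_ae (hpos.mono fun t ht => ht.le) hi]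
  have hsub : Function.support (Inv.inv : ℝ → ℝ) ∈ ae ν := hpos.mono fun t ht => ht.ne'
  rw [measure_congr (eventuallyEq_univ.2 hsub), measure_univ]
  exact one_pos

lemma gRecip_one_eq [IsProbabilityMeasure ν] (hν : ν (Set.Icc a b)ᶜ = 0) {w : ℂ}
    (hw : OffIcc a b w) : gRecip 1 ν w = w ^ 2 * ∫ t : ℝ, 1 / (w - t) ∂ν := by
  have i1 := integrable_of_continuousOn_Icc hν (hw.continuousOn_div Complex.continuous_ofReal)
  have e : ∫ t : ℝ, w * (1 / (w - t)) ∂ν = ∫ t : ℝ, (1 + t / (w - t)) ∂ν := by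
    refine integral_congr_ae ?_
    filter_upwards [ae_mem_Icc hν] with t ht
    have := hw.sub_ne ht
    field_simp
    ring
  rw [integral_const_mul, integral_add (integrable_const _) i1] at e
  simp only [integral_const, probReal_univ, one_smul] at e
  unfold gRecip
  rw [sq, mul_assoc, e]
  push_cast
  ring

/-- For `γ = 1`, `gRecip` equals `-k²` with `k` locally invertible at `0`, so that over `x > 0`
the solution is `m = 1 / ψ (i √x)` with `ψ` the local inverse of `k`. -/
lemma exists_boundary_expansion [IsProbabilityMeasure ν] (ha : 0 < a)
    (hν : ν (Set.Icc a b)ᶜ = 0) :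
    ∃ M : ℝ → ℂ, (∀ᶠ x : ℝ in 𝓝[>] 0, Tendsto (limitingCauchyTransform 1 ν)
        (𝓝[{z : ℂ | 0 < z.im}] (x : ℂ)) (𝓝 (M x)) ∧ ContinuousAt M x) ∧
      Tendsto (fun x : ℝ => √x * M x) (𝓝[>] 0)
        (𝓝 (-Complex.I * (√(∫ t : ℝ, t⁻¹ ∂ν) : ℝ))) := by
  set κ := ∫ t : ℝ, t⁻¹ ∂ν with hκ
  have hκ0 : 0 < κ := integral_inv_pos ha hν
  have hc0 : (√κ : ℂ) ≠ 0 := Complex.ofReal_ne_zero.2 (Real.sqrt_pos.2 hκ0).ne'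
  have hoff : OffIcc a b (0 : ℂ) := by simpa using offIcc_of_lt (b := b) ha
  set L : ℂ → ℂ := fun w => ∫ t : ℝ, 1 / (w - t) ∂ν with hL
  have hLan : AnalyticAt ℂ L 0 :=
    analyticAt_integral_div_sub (φ := fun _ => 1) hν hoff continuous_const
  have hL0 : -L 0 = κ := by
    rw [hκ, ← integral_complex_ofReal, hL, ← integral_neg]
    congr 1
    ext t
    rw [zero_sub, one_div, inv_neg, neg_neg, Complex.ofReal_inv]
  set k : ℂ → ℂ := fun w => w * (-L w) ^ (2⁻¹ : ℂ) with hk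
  have hsan : AnalyticAt ℂ (fun w => (-L w) ^ (2⁻¹ : ℂ)) 0 := by
    refine hLan.neg.cpow analyticAt_const ?_
    rw [Pi.neg_apply, hL0]
    exact Complex.ofReal_mem_slitPlane.2 hκ0
  have hsqrt : ∀ {x : ℝ}, 0 ≤ x → (x : ℂ) ^ (2⁻¹ : ℂ) = (√x : ℝ) := by
    intro x hx
    rw [Real.sqrt_eq_rpow, Complex.ofReal_cpow hx]
    norm_num
  have hkd : HasStrictDerivAt k (√κ : ℂ) 0 := by
    refine (analyticAt_id.mul hsan).hasStrictDerivAt.congr_deriv ?_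
    have := (hasDerivAt_id (0 : ℂ)).mul hsan.differentiableAt.hasDerivAt
    rw [this.deriv]
    simp [hL0, hsqrt hκ0.le]
  have hk0 : k 0 = 0 := by simp [hk]
  have hksq : ∀ w, OffIcc a b w → gRecip 1 ν w = -(k w) ^ 2 := by
    intro w hw
    rw [gRecip_one_eq hν hw, hk]
    simp only
    rw [mul_pow, Complex.cpow_ofNat_inv_pow]
    ring
  obtain ⟨ψ, hψ0, hψd, hψ⟩ := exists_local_rightInverse hkd hc0
  rw [hk0] at hψ0 hψd hψ
  have hψc : Tendsto ψ (𝓝 0) (𝓝 0) := by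
    have := hψd.hasDerivAt.continuousAt.tendsto
    rwa [hψ0] at this
  have hP : ∀ᶠ u in 𝓝 (0 : ℂ), (k (ψ u) = u ∧ ContinuousAt ψ u) ∧ OffIcc a b (ψ u) :=
    hψ.and (hψc.eventually hoff.eventually)
  have hu0 : Tendsto (fun x : ℝ => Complex.I * (√x : ℝ)) (𝓝[>] 0) (𝓝 0) := by
    have : ContinuousAt (fun x : ℝ => Complex.I * (√x : ℝ)) 0 := by fun_prop
    simpa using this.tendsto.mono_left nhdsWithin_le_nhds
  have hu : Tendsto (fun x : ℝ => Complex.I * (√x : ℝ)) (𝓝[>] 0) (𝓝[≠] 0) := by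
    refine tendsto_nhdsWithin_iff.2 ⟨hu0, ?_⟩
    filter_upwards [self_mem_nhdsWithin] with x hx
    exact mul_ne_zero Complex.I_ne_zero (Complex.ofReal_ne_zero.2 (Real.sqrt_pos.2 hx).ne')
  have hslope : Tendsto (fun x : ℝ => ψ (Complex.I * (√x : ℝ)) / (Complex.I * (√x : ℝ)))
      (𝓝[>] 0) (𝓝 (√κ : ℂ)⁻¹) := by
    have := (hasDerivAt_iff_tendsto_slope.1 hψd.hasDerivAt).comp hu
    refine this.congr fun x => ?_
    simp [slope_def_field, hψ0]
  have him : ∀ᶠ x : ℝ in 𝓝[>] 0, 0 < (ψ (Complex.I * (√x : ℝ))).im := by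
    have hre : Tendsto _ _ _ := (Complex.continuous_re.tendsto _).comp hslope
    rw [← Complex.ofReal_inv, Complex.ofReal_re] at hre
    filter_upwards [hre.eventually_const_lt (inv_pos.2 (Real.sqrt_pos.2 hκ0)),
      self_mem_nhdsWithin] with x hx hx0
    have hs : 0 < √x := Real.sqrt_pos.2 hx0
    have e : (ψ (Complex.I * (√x : ℝ)) / (Complex.I * (√x : ℝ))).re =
        (ψ (Complex.I * (√x : ℝ))).im / √x := by
      rw [← div_div, Complex.div_ofReal_re, Complex.div_I]
      simp
    simp only [Function.comp_apply] at hx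
    rw [e] at hx
    exact (div_pos_iff_of_pos_right hs).1 hx
  refine ⟨fun x => (ψ (Complex.I * (√x : ℝ)))⁻¹, ?_, ?_⟩
  · filter_upwards [him, hu0.eventually (eventually_eventually_nhds.2 hP),
      self_mem_nhdsWithin] with x hxim hxP hx0
    have hx0' : 0 < x := hx0
    have hne : ψ (Complex.I * (√x : ℝ)) ≠ 0 := by
      intro h
      simp [h] at hxim
    obtain ⟨⟨-, hc⟩, -⟩ := hxP.self_of_nhds
    constructor
    · set U : ℂ → ℂ := fun z => Complex.I * z ^ (2⁻¹ : ℂ) with hU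
      have hUx : U x = Complex.I * (√x : ℝ) := by rw [hU, ← hsqrt hx0'.le]
      have hUc : Tendsto U (𝓝 (x : ℂ)) (𝓝 (Complex.I * (√x : ℝ))) := by
        rw [← hUx]
        exact continuousAt_const.mul (continuousAt_id.cpow continuousAt_const
          (Complex.ofReal_mem_slitPlane.2 hx0'))
      have hψU := hc.tendsto.comp hUc
      refine ((hψU.inv₀ hne).mono_left nhdsWithin_le_nhds).congr' ?_
      filter_upwards [nhdsWithin_le_nhds (hUc.eventually hxP),
        nhdsWithin_le_nhds (((Complex.continuous_im.tendsto _).comp hψU).eventually_const_lt hxim),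
        self_mem_nhdsWithin] with z hzP hzim hz
      obtain ⟨⟨e, -⟩, ho⟩ := hzP
      refine (limitingCauchyTransform_gRecip one_pos hν hz hzim ?_).symm
      rw [Function.comp_apply, hksq _ ho, e, hU]
      simp only
      rw [mul_pow, Complex.I_sq, Complex.cpow_ofNat_inv_pow]
      ring
    · refine ContinuousAt.inv₀ ?_ hne
      exact ContinuousAt.comp (f := fun x : ℝ => Complex.I * (√x : ℝ)) hc (by fun_prop)
  · have h1 := (hslope.inv₀ (inv_ne_zero hc0)).const_mul (-Complex.I)
    rw [inv_inv] at h1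
    refine h1.congr fun x => ?_
    rw [inv_div, div_eq_mul_inv, ← mul_assoc, ← mul_assoc, neg_mul, Complex.I_mul_I]
    simp

/-! ### The expansion of `g` at infinity -/

lemma gChart_eq_gRecip [IsFiniteMeasure ν] (ha : 0 < a) (hν : ν (Set.Icc a b)ᶜ = 0) :
    gChart γ ν = gRecip γ ν := by
  have hoff : OffIcc a b (0 : ℂ) := by simpa using offIcc_of_lt (b := b) ha
  have hev : (fun z : ℂ => g γ ν (1 / z)) =ᶠ[𝓝[≠] 0] gRecip γ ν := by
    filter_upwards [self_mem_nhdsWithin] with w hw using g_one_div hw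
  have hlim : Tendsto (fun z : ℂ => g γ ν (1 / z)) (𝓝[≠] 0) (𝓝 0) := by
    have := (analyticAt_gRecip (γ := γ) hν hoff).continuousAt.tendsto
    rw [gRecip_zero] at this
    exact (this.mono_left nhdsWithin_le_nhds).congr' hev.symm
  ext w
  rcases eq_or_ne w 0 with rfl | hw
  · rw [gChart, Function.update_self, hlim.limUnder_eq, gRecip_zero]
  · rw [gChart, Function.update_of_ne hw, g_one_div hw]

lemma gInfty_eq [IsFiniteMeasure ν] (ha : 0 < a) (hν : ν (Set.Icc a b)ᶜ = 0) :
    gInfty γ ν = 0 := by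
  rw [gInfty, gChart_eq_gRecip ha hν, gRecip_zero]

lemma gInfty'_eq [IsProbabilityMeasure ν] (ha : 0 < a) (hν : ν (Set.Icc a b)ᶜ = 0) :
    gInfty' γ ν = ((1 - γ : ℝ) : ℂ) := by
  have := (hasStrictDerivAt_gRecip_ofReal (γ := γ) (x := 0) hν (offIcc_of_lt ha)).hasDerivAt
  rw [Complex.ofReal_zero, shrink_zero ha hν] at this
  rw [gInfty', gChart_eq_gRecip ha hν, this.deriv]

lemma gInfty''_eq [IsFiniteMeasure ν] (ha : 0 < a) (hν : ν (Set.Icc a b)ᶜ = 0) :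
    gInfty'' γ ν = ((-(2 * γ * ∫ t : ℝ, t⁻¹ ∂ν) : ℝ) : ℂ) := by
  have hoff : OffIcc a b (0 : ℂ) := by simpa using offIcc_of_lt (b := b) ha
  set J : ℂ → ℂ := fun w => ∫ t : ℝ, (t : ℂ) / (w - t) ∂ν with hJ
  have hJan : AnalyticAt ℂ J 0 := analyticAt_integral_div_sub hν hoff Complex.continuous_ofReal
  have hJ0 : deriv J 0 = -((∫ t : ℝ, t⁻¹ ∂ν : ℝ) : ℂ) := by
    rw [(hasDerivAt_integral_div_sub hν hoff Complex.continuous_ofReal).deriv,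
      ← integral_complex_ofReal, ← integral_neg]
    refine integral_congr_ae ?_
    filter_upwards [ae_mem_Icc hν] with t ht
    have : (t : ℂ) ≠ 0 := Complex.ofReal_ne_zero.2 (ha.trans_le ht.1).ne'
    push_cast
    field_simp
    ring
  have hd1 : deriv (gRecip γ ν) =ᶠ[𝓝 0] fun w => 1 + γ * (J w + w * deriv J w) := by
    filter_upwards [hJan.eventually_analyticAt] with w hw
    have : HasDerivAt (gRecip γ ν) _ w := (hasDerivAt_id w).add
      (((hasDerivAt_id w).mul hw.differentiableAt.hasDerivAt).const_mul (γ : ℂ))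
    rw [this.deriv]
    simp
  have hd2 := ((hJan.differentiableAt.hasDerivAt.add ((hasDerivAt_id (0 : ℂ)).mul
    hJan.deriv.differentiableAt.hasDerivAt)).const_mul (γ : ℂ)).const_add 1
  rw [gInfty'', gChart_eq_gRecip ha hν, iteratedDeriv_succ, iteratedDeriv_one, hd1.deriv_eq]
  refine hd2.deriv.trans ?_
  rw [hJ0]
  push_cast
  simp
  ring

/-! ### Edges -/

lemma not_isLeftEdge_zero {ρ : ℝ → ℝ} (h : ∀ᶠ x : ℝ in 𝓝 0, x ≠ 0 → ρ x = 0) :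
    ¬ IsLeftEdge ρ 0 := by
  intro hl
  obtain ⟨ε, hε, H⟩ := Metric.eventually_nhds_iff.1 h
  obtain ⟨δ, hδ, hδ0, hδε⟩ := (hl.and (Ioo_mem_nhdsGT hε)).exists
  have : ∫ x in (0 : ℝ)..(0 + δ), ρ x = 0 := by
    rw [zero_add]
    refine intervalIntegral.integral_zero_ae (Eventually.of_forall fun x hx => ?_)
    rw [Set.uIoc_of_le hδ0.le] at hx
    exact H (by rw [Real.dist_0_eq_abs, abs_of_pos hx.1]; linarith [hx.2]) hx.1.ne'
  linarith [hδ.2]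

/-- The limit makes `ρ` positive and bounded by a multiple of `x ^ (-1 / 2)` near `0`, and the
continuous function `r` makes it measurable there. So `ρ` is integrable near `0`, and its integral
over `(0, δ)` is not a junk value. -/
lemma hasHardEdge_of_tendsto {ρ r : ℝ → ℝ} {c : ℝ} (hc : 0 < c) (hneg : ∀ x < 0, ρ x = 0)
    (hr : ∀ᶠ x in 𝓝[>] 0, ρ x = r x ∧ ContinuousAt r x)
    (hlim : Tendsto (fun x => √x * ρ x) (𝓝[>] 0) (𝓝 c)) : HasHardEdge ρ := by
  have hint : ∀ u v : ℝ, u ≤ v → v ≤ 0 → ∫ x in u..v, ρ x = 0 := by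
    intro u v huv hv
    refine intervalIntegral.integral_zero_ae ?_
    filter_upwards [Measure.ae_ne volume (0 : ℝ)] with x hx0 hx
    rw [Set.uIoc_of_le huv] at hx
    exact hneg x (lt_of_le_of_ne (hx.2.trans hv) hx0)
  refine ⟨?_, fun e he => ?_⟩
  · have hev := (hr.and ((hlim.eventually_const_lt hc).and
      (hlim.eventually_lt_const (lt_add_one c))))
    obtain ⟨ε, hε, H⟩ := mem_nhdsGT_iff_exists_Ioo_subset.1 hev
    filter_upwards [Ioo_mem_nhdsGT (show (0 : ℝ) < ε from hε)] with δ hδ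
    refine ⟨hint _ _ (by linarith [hδ.1]) le_rfl, ?_⟩
    rw [zero_add]
    have hP : ∀ x ∈ Set.Ioc 0 δ, (ρ x = r x ∧ ContinuousAt r x) ∧ 0 < √x * ρ x ∧
        √x * ρ x < c + 1 := fun x hx => H ⟨hx.1, hx.2.trans_lt hδ.2⟩
    have hpos : ∀ x ∈ Set.Ioc 0 δ, 0 < ρ x := fun x hx =>
      (pos_iff_pos_of_mul_pos (hP x hx).2.1).1 (Real.sqrt_pos.2 hx.1)
    refine intervalIntegral.intervalIntegral_pos_of_pos_on ?_
      (fun x hx => hpos x ⟨hx.1, hx.2.le⟩) hδ.1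
    rw [intervalIntegrable_iff_integrableOn_Ioc_of_le hδ.1.le]
    have hb : IntegrableOn (fun x : ℝ => (c + 1) * x ^ (-(1 / 2) : ℝ)) (Set.Ioc 0 δ) := by
      rw [← intervalIntegrable_iff_integrableOn_Ioc_of_le hδ.1.le]
      exact (intervalIntegral.intervalIntegrable_rpow' (by norm_num)).const_mul _
    have hmeas : AEStronglyMeasurable ρ (volume.restrict (Set.Ioc 0 δ)) := by
      have : ContinuousOn r (Set.Ioc 0 δ) := fun x hx => (hP x hx).1.2.continuousWithinAt
      exact (this.congr fun x hx => (hP x hx).1.1).aestronglyMeasurable measurableSet_Ioc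
    refine hb.mono' hmeas ?_
    filter_upwards [ae_restrict_mem measurableSet_Ioc] with x hx
    have hs := Real.sqrt_pos.2 hx.1
    rw [Real.norm_of_nonneg (hpos x hx).le, Real.rpow_neg hx.1.le, ← Real.sqrt_eq_rpow,
      ← div_eq_mul_inv, le_div_iff₀ hs, mul_comm]
    exact (hP x hx).2.2.le
  · by_contra! h0
    have hsmall : Set.Ioo 0 (-e) ∈ 𝓝[>] (0 : ℝ) := Ioo_mem_nhdsGT (by linarith)
    rcases he with he | he
    · obtain ⟨δ, hδ, hδ'⟩ := (he.and hsmall).exists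
      have := hint e (e + δ) (by linarith [hδ'.1]) (by linarith [hδ'.2])
      linarith [hδ.2]
    · obtain ⟨δ, hδ, hδ'⟩ := (he.and hsmall).exists
      have := hint (e - δ) e (by linarith [hδ'.1]) h0.le
      linarith [hδ.1]

end Wishart

end

theorem mainTheorem9 (γ : ℝ) (hγ : 0 < γ) (ν : Measure ℝ) [IsProbabilityMeasure ν]
    (hν : ∃ a b : ℝ, 0 < a ∧ ν (Set.Icc a b)ᶜ = 0) :
    -- the objects in the statement are well defined
    ((∀ z : ℂ, 0 < z.im → ∃! m : ℂ, Wishart.IsFixedPoint γ ν z m) ∧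
      (∀ μ : Measure ℝ, Wishart.IsLimitingMeasure γ ν μ → ∀ z : ℂ, 0 < z.im →
        Wishart.limitingCauchyTransform γ ν z = Wishart.cauchyTransform μ z) ∧
      (∀ᶠ x : ℝ in 𝓝[≠] (0 : ℝ), Tendsto (Wishart.limitingCauchyTransform γ ν)
        (𝓝[{z : ℂ | 0 < z.im}] (x : ℂ)) (𝓝 (Wishart.boundaryValue γ ν x))) ∧
      AnalyticAt ℂ (Wishart.gChart γ ν) 0) ∧
    -- characterizations of the presence of a hard edge
    (Wishart.HasHardEdge (Wishart.density γ ν) ↔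
      Wishart.gInfty γ ν = 0 ∧ Wishart.gInfty' γ ν = 0 ∧ Wishart.gInfty'' γ ν < 0) ∧
    (Wishart.HasHardEdge (Wishart.density γ ν) ↔ γ = 1) ∧
    -- inverse square root behavior at the hard edge
    (Wishart.HasHardEdge (Wishart.density γ ν) →
      IsEquivalent (𝓝[>] (0 : ℝ)) (Wishart.density γ ν) (fun x : ℝ =>
        1 / Real.pi * (2 / -(Wishart.gInfty'' γ ν).re) ^ (-(1 / 2) : ℝ) *
          x ^ (-(1 / 2) : ℝ))) := by
  obtain ⟨a, b, ha, hab⟩ := hν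
  have hκ := Wishart.integral_inv_pos ha hab
  have h2 : Wishart.gInfty'' γ ν < 0 := by
    rw [Wishart.gInfty''_eq ha hab, ← Complex.ofReal_zero, Complex.real_lt_real]
    have : 0 < 2 * γ * ∫ t : ℝ, t⁻¹ ∂ν := by positivity
    linarith
  have hreg : γ ≠ 1 → _ := Wishart.eventually_tendsto_ofReal_of_ne_one hγ ha hab
  have hne : γ ≠ 1 → ¬ Wishart.HasHardEdge (Wishart.density γ ν) := by
    intro h1 hh
    refine Wishart.not_isLeftEdge_zero ?_ hh.1
    filter_upwards [hreg h1] with x hx hx0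
    obtain ⟨r, hr⟩ := hx hx0
    exact Wishart.density_eq_zero hr
  -- For `γ = 1` the density vanishes on the negative axis and is equivalent to a multiple of
  -- `x ^ (-1 / 2)` on the positive one.
  have hone : γ = 1 → Tendsto (fun x : ℝ => √x * Wishart.density γ ν x) (𝓝[>] 0)
      (𝓝 (1 / Real.pi * √(∫ t : ℝ, t⁻¹ ∂ν))) ∧ Wishart.HasHardEdge (Wishart.density γ ν) := by
    rintro rfl
    obtain ⟨M, hM, hlim⟩ := Wishart.exists_boundary_expansion ha hab
    have hρ : ∀ᶠ x : ℝ in 𝓝[>] 0,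
        Wishart.density 1 ν x = -(1 / Real.pi) * (M x).im ∧
          ContinuousAt (fun x => -(1 / Real.pi) * (M x).im) x := by
      filter_upwards [hM] with x hx
      exact ⟨by rw [Wishart.density, Wishart.boundaryValue_eq hx.1],
        continuousAt_const.mul (Complex.continuous_im.continuousAt.comp hx.2)⟩
    have ht : Tendsto (fun x : ℝ => √x * Wishart.density 1 ν x) (𝓝[>] 0)
        (𝓝 (1 / Real.pi * √(∫ t : ℝ, t⁻¹ ∂ν))) := by
      have h3 := ((Complex.continuous_im.tendsto _).comp hlim).const_mul (-(1 / Real.pi))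
      rw [Complex.im_mul_ofReal, Complex.neg_im, Complex.I_im] at h3
      rw [show 1 / Real.pi * √(∫ t : ℝ, t⁻¹ ∂ν) =
        -(1 / Real.pi) * (-1 * √(∫ t : ℝ, t⁻¹ ∂ν)) by ring]
      refine h3.congr' ?_
      filter_upwards [hρ] with x hx
      rw [hx.1, Function.comp_apply, Complex.im_ofReal_mul]
      ring
    have hpos : 0 < 1 / Real.pi * √(∫ t : ℝ, t⁻¹ ∂ν) :=
      mul_pos (one_div_pos.2 Real.pi_pos) (Real.sqrt_pos.2 hκ)
    refine ⟨ht, Wishart.hasHardEdge_of_tendsto hpos (fun x hx => ?_) hρ ht⟩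
    obtain ⟨r, hr⟩ := Wishart.tendsto_ofReal_of_neg ha hab hx
    exact Wishart.density_eq_zero hr
  have hiff : Wishart.HasHardEdge (Wishart.density γ ν) ↔ γ = 1 :=
    ⟨fun h => by_contra fun h1 => hne h1 h, fun h => (hone h).2⟩
  refine ⟨⟨fun z hz => Wishart.existsUnique_isFixedPoint hγ hab hz,
    fun μ hμ z hz => Wishart.limitingCauchyTransform_eq hγ hab hz (hμ.2 z hz), ?_, ?_⟩,
    ?_, hiff, fun hh => ?_⟩
  · have key : ∀ᶠ x : ℝ in 𝓝[≠] 0, ∃ m : ℂ, Tendsto (Wishart.limitingCauchyTransform γ ν)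
        (𝓝[{z : ℂ | 0 < z.im}] (x : ℂ)) (𝓝 m) := by
      by_cases h1 : γ = 1
      · subst h1
        rw [← Set.Iio_union_Ioi, nhdsWithin_union, eventually_sup]
        constructor
        · filter_upwards [self_mem_nhdsWithin] with x hx
          obtain ⟨r, hr⟩ := Wishart.tendsto_ofReal_of_neg ha hab hx
          exact ⟨r, hr⟩
        · obtain ⟨M, hM, -⟩ := Wishart.exists_boundary_expansion ha hab
          filter_upwards [hM] with x hx using ⟨M x, hx.1⟩
      · filter_upwards [nhdsWithin_le_nhds (hreg h1), self_mem_nhdsWithin] with x hx hx0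
        obtain ⟨r, hr⟩ := hx hx0
        exact ⟨r, hr⟩
    filter_upwards [key] with x hx
    obtain ⟨m, hm⟩ := hx
    rwa [Wishart.boundaryValue_eq hm]
  · rw [Wishart.gChart_eq_gRecip ha hab]
    exact Wishart.analyticAt_gRecip hab (by simpa using Wishart.offIcc_of_lt (b := b) ha)
  · rw [hiff, Wishart.gInfty_eq ha hab, Wishart.gInfty'_eq ha hab, Complex.ofReal_eq_zero,
      sub_eq_zero]
    exact ⟨fun h => ⟨rfl, h.symm, h2⟩, fun h => h.2.1.symm⟩
  · have h1 := hiff.1 hh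
    have ht := (hone h1).1
    subst h1
    set κ := ∫ t : ℝ, t⁻¹ ∂ν
    have hc : 1 / Real.pi * √κ ≠ 0 :=
      (mul_pos (one_div_pos.2 Real.pi_pos) (Real.sqrt_pos.2 hκ)).ne'
    have hconst : (2 / -(Wishart.gInfty'' 1 ν).re) ^ (-(1 / 2) : ℝ) = √κ := by
      rw [Wishart.gInfty''_eq ha hab, Complex.ofReal_re,
        show 2 / -(-(2 * 1 * κ)) = κ⁻¹ by field_simp, Real.rpow_neg (inv_nonneg.2 hκ.le),
        Real.inv_rpow hκ.le, inv_inv, Real.sqrt_eq_rpow]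
    rw [hconst]
    refine isEquivalent_of_tendsto_one ?_
    have h3 := ht.div_const (1 / Real.pi * √κ)
    rw [div_self hc] at h3
    refine h3.congr' ?_
    filter_upwards [self_mem_nhdsWithin] with x hx
    have hx0 : 0 < x := hx
    have hs := Real.sqrt_pos.2 hx0
    rw [Pi.div_apply, Real.rpow_neg hx0.le, ← Real.sqrt_eq_rpow]
    field_simp
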